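/- Let $d\in\mathbb N$, let $B_d$ be the open unit ball of $\mathbb C^d$, and let $\mathcal H^2_d$ be the Drury–Arveson space, i.e. the reproducing kernel Hilbert space on $B_d$ with kernel $k(x,y)=\frac{1}{1-\langle x,y\rangle}$ and kernel functions $k_x(y)=k(y,x)$. A variety in $B_d$ is a set of the form $\{x\in B_d: f(x)=0 \text{ for all } f\in S\}$ with $\emptyset\neq S\subseteq\mathcal H^2_d$. For a variety $V$ let $H_V=\overline{\operatorname{span}}\{k_x:x\in V\}\subseteq\mathcal H^2_d$, regarded as a reproducing kernel Hilbert space of functions on $V$ by restriction, and let $\mathcal M_V$ be its multiplier algebra, that is, the algebra of all $f:V\to\mathbb C$ with $fH_V\subseteq H_V$; for $f\in\mathcal M_V$ let $M_f$ be the bounded operator $h\mapsto fh$ on $H_V$. A matrix $A=[f_{ij}]\in M_m(\mathcal M_V)$ is normed as the operator $[M_{f_{ij}}]$ on $\bigoplus_{i=1}^m H_V$, and for an algebra homomorphism $\varphi:\mathcal M_V\to\mathcal M_W$ put $\|\varphi\|_{cb}=\sup_{m}\|\varphi^{(m)}\|$, where $\varphi^{(m)}[f_{ij}]=[\varphi(f_{ij})]$.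 A multiplier algebra isomorphism is an algebra isomorphism $\varphi:\mathcal M_V\to\mathcal M_W$ with $\|\varphi\|_{cb},\|\varphi^{-1}\|_{cb}<\infty$ of the form $\varphi(f)=f\circ G$ for a bijection $G:W\to V$. A vector valued multiplier on $V$ is a map $F=(f_1,\dots,f_d):V\to\mathbb C^d$ with all $f_i\in\mathcal M_V$, and $\|F\|_{\mathrm{Mult}(V)}$ is the norm of the row operator $(M_{f_1},\dots,M_{f_d}):\bigoplus_{i=1}^d H_V\to H_V$. Let $V\subseteq B_d$ be a variety that contains at least two points, and let $(W_n)_{n\in\mathbb N}$ be a sequence of varieties in $B_d$. For every $n$ let $F_n:V\to W_n$ be a bijection and suppose that $\varphi_n(f)=f\circ F_n^{-1}$, $f\in\mathcal M_V$, defines a multiplier algebra isomorphism $\varphi_n:\mathcal M_V\to\mathcal M_{W_n}$. Assume that $$\|\varphi_n\|_{cb}\,\|\varphi_n^{-1}\|_{cb}\xrightarrow[n\to\infty]{}1 .$$ Then, for every $n$, $F_n$ is a vector valued multiplier on $V$ and $F_n^{-1}$ is a vector valued multiplier on $W_n$, and $$\|F_n\|_{\mathrm{Mult}(V)}\xrightarrow[n\to\infty]{}1,\qquad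 \|F_n^{-1}\|_{\mathrm{Mult}(W_n)}\xrightarrow[n\to\infty]{}1 .$$ -/

import Mathlib

open scoped ComplexOrder

/-! ### Multipliers of a reproducing kernel Hilbert space of scalar functions -/

namespace RKHSMult

/-- `f : X → ℂ` is a multiplier of `H` if `f * h` belongs to `H` for every `h` in `H`. -/
def IsMultiplier {X : Type*} (H : Type*) [NormedAddCommGroup H] [InnerProductSpace ℂ H]
    [RKHS ℂ H X ℂ] (f : X → ℂ) : Prop :=
  ∀ h : H, ∃ g : H, ∀ x, g x = f x * h x

/-- The multiplier algebra of `H`, an algebra of functions on `X` under pointwise operations. -/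
def multAlg {X : Type*} (H : Type*) [NormedAddCommGroup H] [InnerProductSpace ℂ H]
    [RKHS ℂ H X ℂ] : Subalgebra ℂ (X → ℂ) where
  carrier := {f | IsMultiplier H f}
  mul_mem' := by
    intro a b ha hb h
    obtain ⟨g, hg⟩ := hb h
    obtain ⟨g', hg'⟩ := ha g
    exact ⟨g', fun x => by rw [hg', hg, Pi.mul_apply, mul_assoc]⟩
  add_mem' := by
    intro a b ha hb h
    obtain ⟨g, hg⟩ := ha h
    obtain ⟨g', hg'⟩ := hb h
    exact ⟨g + g', fun x => by simp [hg, hg', add_mul]⟩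
  algebraMap_mem' := by
    intro c h
    exact ⟨c • h, fun x => by simp⟩

/-- The multiplication operator `h ↦ f * h` as a linear map. -/
noncomputable def mulLin {X : Type*} {H : Type*} [NormedAddCommGroup H] [InnerProductSpace ℂ H]
    [RKHS ℂ H X ℂ] (f : multAlg H) : H →ₗ[ℂ] H where
  toFun h := (f.2 h).choose
  map_add' h h' := by
    ext x
    rw [(f.2 (h + h')).choose_spec, RKHS.coe_add, RKHS.coe_add, Pi.add_apply, Pi.add_apply,
      (f.2 h).choose_spec, (f.2 h').choose_spec, mul_add]
  map_smul' c h := by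
    ext x
    rw [(f.2 (c • h)).choose_spec, RingHom.id_apply, RKHS.coe_smul, RKHS.coe_smul, Pi.smul_apply,
      Pi.smul_apply, (f.2 h).choose_spec, smul_eq_mul, smul_eq_mul, mul_left_comm]

theorem mulLin_apply {X : Type*} {H : Type*} [NormedAddCommGroup H] [InnerProductSpace ℂ H]
    [RKHS ℂ H X ℂ] (f : multAlg H) (h : H) (x : X) :
    mulLin f h x = (f : X → ℂ) x * h x :=
  (f.2 h).choose_spec x

/-- The multiplication operator `M_f : H → H`, `h ↦ f * h`; it is bounded by the closed graph
theorem. -/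
noncomputable def mulOp {X : Type*} {H : Type*} [NormedAddCommGroup H] [InnerProductSpace ℂ H]
    [CompleteSpace H] [RKHS ℂ H X ℂ] (f : multAlg H) : H →L[ℂ] H :=
  ContinuousLinearMap.ofSeqClosedGraph (g := mulLin f) (by
    intro u a b hu hfu
    ext x
    have h1 := ((RKHS.continuous_eval (H := H) x).tendsto b).comp hfu
    have h2 := (((RKHS.continuous_eval (H := H) x).tendsto a).comp hu).const_mul ((f : X → ℂ) x)
    rw [mulLin_apply]
    refine tendsto_nhds_unique h1 (h2.congr fun n => ?_)
    simp [mulLin_apply])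

/-- The defining property of `M_f`. -/
theorem mulOp_apply {X : Type*} {H : Type*} [NormedAddCommGroup H] [InnerProductSpace ℂ H]
    [CompleteSpace H] [RKHS ℂ H X ℂ] (f : multAlg H) (h : H) (x : X) :
    mulOp f h x = (f : X → ℂ) x * h x :=
  mulLin_apply f h x

/-- The row operator `(g₁, …, g_d) ↦ ∑ i, f i * g i` from the Hilbert space direct sum of `d` copies
of `H` to `H`. -/
noncomputable def rowOp {X : Type*} {H : Type*} [NormedAddCommGroup H] [InnerProductSpace ℂ H]
    [CompleteSpace H] [RKHS ℂ H X ℂ] {d : ℕ} (f : Fin d → multAlg H) :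
    PiLp 2 (fun _ : Fin d => H) →L[ℂ] H :=
  ∑ i, mulOp (f i) ∘L PiLp.proj 2 (fun _ : Fin d => H) i

/-- The operator on the Hilbert space direct sum of `n` copies of `H` given by an `n × n` matrix of
multipliers. Its operator norm is the norm of the matrix in `M_n(Mult(H))`. -/
noncomputable def matOp {X : Type*} {H : Type*} [NormedAddCommGroup H] [InnerProductSpace ℂ H]
    [CompleteSpace H] [RKHS ℂ H X ℂ] {n : ℕ} (A : Matrix (Fin n) (Fin n) (multAlg H)) :
    PiLp 2 (fun _ : Fin n => H) →L[ℂ] PiLp 2 (fun _ : Fin n => H) :=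
  (PiLp.continuousLinearEquiv 2 ℂ (fun _ : Fin n => H)).symm.toContinuousLinearMap ∘L
    ContinuousLinearMap.pi (fun i => rowOp (A i))

/-- The operator norm (possibly `⊤`) of the entrywise map
`φ⁽ⁿ⁾ : M_n(Mult(H)) → M_n(Mult(K))` induced by `φ`. -/
noncomputable def ampNorm {X Y : Type*} {H K : Type*}
    [NormedAddCommGroup H] [InnerProductSpace ℂ H] [CompleteSpace H] [RKHS ℂ H X ℂ]
    [NormedAddCommGroup K] [InnerProductSpace ℂ K] [CompleteSpace K] [RKHS ℂ K Y ℂ]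
    (φ : multAlg H →ₐ[ℂ] multAlg K) (n : ℕ) : ENNReal :=
  ⨆ (A : Matrix (Fin n) (Fin n) (multAlg H)) (_ : ‖matOp A‖ ≤ 1), ‖matOp (A.map φ)‖ₑ

/-- The completely bounded norm `‖φ‖_cb = sup_n ‖φ⁽ⁿ⁾‖`, possibly `⊤`. -/
noncomputable def cbNorm {X Y : Type*} {H K : Type*}
    [NormedAddCommGroup H] [InnerProductSpace ℂ H] [CompleteSpace H] [RKHS ℂ H X ℂ]
    [NormedAddCommGroup K] [InnerProductSpace ℂ K] [CompleteSpace K] [RKHS ℂ K Y ℂ]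
    (φ : multAlg H →ₐ[ℂ] multAlg K) : ENNReal :=
  ⨆ n : ℕ, ampNorm φ n

/-- A multiplier algebra isomorphism: a completely bounded algebra isomorphism with completely
bounded inverse which is composition with a bijection `G : Y → X`. -/
structure IsMultAlgIso {X Y : Type*} {H K : Type*}
    [NormedAddCommGroup H] [InnerProductSpace ℂ H] [CompleteSpace H] [RKHS ℂ H X ℂ]
    [NormedAddCommGroup K] [InnerProductSpace ℂ K] [CompleteSpace K] [RKHS ℂ K Y ℂ]
    (φ : multAlg H ≃ₐ[ℂ] multAlg K) : Prop where
  cb : cbNorm φ.toAlgHom < ⊤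
  cb_symm : cbNorm φ.symm.toAlgHom < ⊤
  comp : ∃ G : Y ≃ X, ∀ (f : multAlg H) (y : Y), (φ f : Y → ℂ) y = (f : X → ℂ) (G y)

/-- A vector valued multiplier: all coordinate functions of `F` are multipliers. -/
def IsVecMultiplier {X : Type*} (H : Type*) [NormedAddCommGroup H] [InnerProductSpace ℂ H]
    [RKHS ℂ H X ℂ] {d : ℕ} (F : X → EuclideanSpace ℂ (Fin d)) : Prop :=
  ∀ i, (fun x => F x i) ∈ multAlg H

/-- The multiplier norm of a vector valued multiplier: the operator norm of the row operator
`(M_{F₁}, …, M_{F_d})`. -/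
noncomputable def vecMultNorm {X : Type*} (H : Type*) [NormedAddCommGroup H]
    [InnerProductSpace ℂ H] [CompleteSpace H] [RKHS ℂ H X ℂ] {d : ℕ}
    (F : X → EuclideanSpace ℂ (Fin d)) (hF : IsVecMultiplier H F) : ℝ :=
  ‖rowOp (H := H) (fun i => ⟨fun x => F x i, hF i⟩)‖

end RKHSMult

/-! ### The Drury-Arveson space and varieties in the ball -/

namespace DruryArveson

/-- The open unit ball of `ℂ^d`. -/
abbrev UBall (d : ℕ) : Type := Metric.ball (0 : EuclideanSpace ℂ (Fin d)) 1

/-- The kernel `k(x, y) = 1 / (1 - ⟨x, y⟩)`, where `⟨x, y⟩` is linear in `x` (this is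
`inner ℂ y x` in Mathlib). -/
noncomputable def ker {d : ℕ} (x y : UBall d) : ℂ :=
  1 / (1 - inner ℂ (y : EuclideanSpace ℂ (Fin d)) (x : EuclideanSpace ℂ (Fin d)))

/-- The kernel as a matrix of operators on the one-dimensional space `ℂ` (scalar
multiplications). -/
noncomputable def kerMat (d : ℕ) : Matrix (UBall d) (UBall d) (ℂ →L[ℂ] ℂ) :=
  Matrix.of fun x y => ker x y • (1 : ℂ →L[ℂ] ℂ)

theorem norm_inner_lt_one {d : ℕ} (x y : UBall d) :
    ‖inner ℂ (y : EuclideanSpace ℂ (Fin d)) (x : EuclideanSpace ℂ (Fin d))‖ < 1 := by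
  have hx : ‖(x : EuclideanSpace ℂ (Fin d))‖ < 1 := mem_ball_zero_iff.mp x.2
  have hy : ‖(y : EuclideanSpace ℂ (Fin d))‖ < 1 := mem_ball_zero_iff.mp y.2
  exact (norm_inner_le_norm _ _).trans_lt
    (mul_lt_one_of_nonneg_of_lt_one_left (norm_nonneg _) hy hx.le)

theorem posSemidef_gram {X E : Type*} [NormedAddCommGroup E] [InnerProductSpace ℂ E] (v : X → E) :
    (Matrix.of fun x y : X => (inner ℂ (v x) (v y) : ℂ)).PosSemidef := by
  refine ⟨?_, fun c => ?_⟩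
  · ext x y
    simp
  · have h : (c.sum fun i ci => c.sum fun j cj =>
        star ci * (Matrix.of fun x y : X => (inner ℂ (v x) (v y) : ℂ)) i j * cj) =
        inner ℂ (c.sum fun i ci => ci • v i) (c.sum fun i ci => ci • v i) := by
      simp only [Finsupp.sum, sum_inner, inner_sum, inner_smul_left, inner_smul_right,
        Matrix.of_apply, Finset.mul_sum]
      rw [Finset.sum_comm]
      refine Finset.sum_congr rfl fun i _ => Finset.sum_congr rfl fun j _ => ?_
      simp only [RCLike.star_def]
      ring
    rw [h, inner_self_eq_norm_sq_to_K]
    simp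

theorem posSemidef_pow (d n : ℕ) : (Matrix.of fun x y : UBall d =>
    (inner ℂ (y : EuclideanSpace ℂ (Fin d)) (x : EuclideanSpace ℂ (Fin d))) ^ n).PosSemidef := by
  induction n with
  | zero =>
    have h := posSemidef_gram (fun _ : UBall d => (1 : ℂ))
    simpa using h
  | succ n ih =>
    have h := (posSemidef_gram
      (fun x : UBall d => (x : EuclideanSpace ℂ (Fin d)))).transpose
    exact ih.hadamard h

theorem posSemidef_ker (d : ℕ) :
    (Matrix.of fun x y : UBall d => ker x y).PosSemidef := by
  refine ⟨?_, fun v => ?_⟩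
  · ext x y
    simp [ker]
  · have key : HasSum (fun n : ℕ => v.sum fun i vi => v.sum fun j vj =>
        star vi * (Matrix.of (fun x y : UBall d => (inner ℂ (y : EuclideanSpace ℂ (Fin d))
          (x : EuclideanSpace ℂ (Fin d))) ^ n)) i j * vj)
        (v.sum fun i vi => v.sum fun j vj =>
          star vi * (Matrix.of fun x y : UBall d => ker x y) i j * vj) := by
      unfold Finsupp.sum
      refine hasSum_sum fun i _ => hasSum_sum fun j _ => ?_
      refine HasSum.mul_right _ (HasSum.mul_left _ ?_)
      simp only [Matrix.of_apply, ker, one_div]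
      exact hasSum_geometric_of_norm_lt_one (norm_inner_lt_one i j)
    exact key.nonneg fun n => (posSemidef_pow d n).2 v

theorem posSemidef_kerMat (d : ℕ) : (kerMat d).PosSemidef := by
  have hk := posSemidef_ker d
  have tf := (RKHS.posSemidef_tfae (K := kerMat d)).out 0 2 rfl rfl
  refine tf.mpr ⟨?_, fun v => ?_⟩
  · ext x y
    have := congrFun (congrFun hk.1 x) y
    simp only [Matrix.conjTranspose_apply, Matrix.of_apply] at this
    simp [kerMat, ← this]
  · have h := (Complex.le_def.mp (hk.2 v)).1
    have e : (v.sum fun x w => v.sum fun x' w' => inner ℂ ((kerMat d x' x) w) w') =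
        v.sum fun i vi => v.sum fun j vj =>
          star vi * (Matrix.of fun x y : UBall d => ker x y) i j * vj := by
      refine Finsupp.sum_congr fun x _ => Finsupp.sum_congr fun y _ => ?_
      have hxy := congrFun (congrFun hk.1 x) y
      simp only [Matrix.conjTranspose_apply, Matrix.of_apply] at hxy
      simp only [Matrix.of_apply]
      rw [← hxy]
      simp [kerMat]
      ring
    rw [e]
    exact h

instance fact_posSemidef_kerMat (d : ℕ) : Fact (kerMat d).PosSemidef := ⟨posSemidef_kerMat d⟩

/-- The Drury-Arveson space: the reproducing kernel Hilbert space on the ball with kernel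
`1 / (1 - ⟨x, y⟩)`. -/
abbrev H2 (d : ℕ) : Type := RKHS.OfKernel (kerMat d)

/-- The kernel function `k_x` of the Drury-Arveson space, `k_x(y) = k(y, x)`. -/
noncomputable def kerFun {d : ℕ} (x : UBall d) : H2 d := RKHS.kerFun (H2 d) x 1

theorem kerFun_apply {d : ℕ} (x y : UBall d) : kerFun x y = ker y x := by
  rw [kerFun, RKHS.kerFun_apply, RKHS.OfKernel.kernel_ofKernel]
  simp [kerMat]

theorem inner_kerFun {d : ℕ} (x : UBall d) (f : H2 d) : inner ℂ (kerFun x) f = f x := by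
  simp [kerFun]

/-- `V` is a (sub)variety of the ball: the common zero set of a non-empty family of functions in the
Drury-Arveson space. -/
def IsVariety {d : ℕ} (V : Set (UBall d)) : Prop :=
  ∃ S : Set (H2 d), S.Nonempty ∧ V = {x | ∀ f ∈ S, f x = 0}

/-- The closed linear span `H_V` of the kernel functions `k_x`, `x ∈ V`, in the Drury-Arveson
space. -/
noncomputable def HV {d : ℕ} (V : Set (UBall d)) : Submodule ℂ (H2 d) :=
  (Submodule.span ℂ (kerFun '' V)).topologicalClosure

instance completeSpace_HV {d : ℕ} (V : Set (UBall d)) : CompleteSpace (HV V) :=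
  (Submodule.isClosed_topologicalClosure _).completeSpace_coe

/-- `H_V` as a reproducing kernel Hilbert space of functions on `V`, by restricting functions on the
ball to `V`. -/
noncomputable instance rkhs_HV {d : ℕ} (V : Set (UBall d)) : RKHS ℂ (HV V) V ℂ where
  coeCLM := ContinuousLinearMap.pi fun x : V =>
    (ContinuousLinearMap.proj (R := ℂ) (φ := fun _ : UBall d => ℂ) (x : UBall d)) ∘L
      (RKHS.coeCLM ℂ : H2 d →L[ℂ] UBall d → ℂ) ∘L (HV V).subtypeL
  coeCLM_injective := by
    refine (injective_iff_map_eq_zero _).mpr fun h hh => ?_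
    have hz : ∀ x ∈ V, (h : H2 d) x = 0 := fun x hx => congrFun hh ⟨x, hx⟩
    have hle : Submodule.span ℂ (kerFun '' V) ≤ (ℂ ∙ (h : H2 d))ᗮ := by
      rw [Submodule.span_le]
      rintro _ ⟨x, hx, rfl⟩
      rw [SetLike.mem_coe, Submodule.mem_orthogonal_singleton_iff_inner_left, inner_kerFun]
      exact hz x hx
    have hmem := Submodule.topologicalClosure_minimal _ hle
      (Submodule.isClosed_orthogonal _) h.2
    rw [Submodule.mem_orthogonal_singleton_iff_inner_left, inner_self_eq_zero] at hmem
    exact Subtype.ext hmem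

theorem HV_apply {d : ℕ} (V : Set (UBall d)) (h : HV V) (x : V) :
    h x = (h : H2 d) (x : UBall d) := rfl

/-- The multiplier algebra `M_V` of `H_V`, an algebra of functions on `V`. -/
noncomputable abbrev MV {d : ℕ} (V : Set (UBall d)) : Subalgebra ℂ (V → ℂ) :=
  RKHSMult.multAlg (HV V)

end DruryArveson

/-!
For two points of a reproducing kernel Hilbert space with kernel functions `k_x`, let
`kerCos x y = |⟨k_x, k_y⟩| / (‖k_x‖ ‖k_y‖)`. On `H_V` this is the restriction of the function
`ballCos` on the ball, so `(1 - ballCos²)^(1/2)` is the pseudohyperbolic distance.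

*Upper bounds.* The coordinate functions form a contractive row of multipliers of every `H_V`
(`exists_coord_multiplier`), and a completely bounded map enlarges the norm of a row by at most its
cb norm (`norm_rowOp_map_le`). Hence `‖F_n‖ ≤ ‖φ_n⁻¹‖_cb` and `‖F_n⁻¹‖ ≤ ‖φ_n‖_cb`. Both cb norms are
at least `1` because the maps are unital, so both tend to `1` together with their product.

*Almost isometry.* For `y` in the ball there is an explicit contractive row of multipliers
`mobiusRow y` that vanishes at `y` and satisfies `‖mobiusRow y x‖² = 1 - ballCos x y ²`. On the other
hand any row of multipliers of norm `N` vanishing at `y` has norm at most `N √(1 - kerCos x y ²)` at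
`x` (`sum_norm_sq_le_of_eq_zero`). Moving `mobiusRow` through `φ_n` and `φ_n⁻¹` shows that
`ballCos (F_n x) (F_n y)` tends to `ballCos x y` for all `x y : V`
(`one_sub_ballCos_sq_comp_le`, `tendsto_of_one_sub_sq_le`).

*Lower bounds.* A map `E` into the ball whose multiplier norm `R` is at most `1` increases `kerCos`
by a definite amount: `(1 + (1 - R²) / 2) (1 - ballCos (E x) (E y)) ≤ 1 - kerCos x y`
(`one_sub_ballCos_le`). This comes from the positivity of the `2 × 2` matrix with entries
`(R² - ⟨E x_i, E x_j⟩) k(x_i, x_j)`. Applied to `F_n` and `F_n⁻¹` at two distinct points of `V` and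
their images, where both sides have the same nonzero limit up to the factor `1 + (1 - R²) / 2`, it
forces `liminf R ≥ 1`.

Contractivity of rows is obtained from positivity of `(1 - ∑ f_l(x) conj f_l(y)) k(x, y)`
(`exists_rowOp_norm_le_one`); for the two rows above this kernel has rank one.
-/

namespace RKHSMult

open scoped ComplexConjugate

variable {X : Type*} {H : Type*} [NormedAddCommGroup H] [InnerProductSpace ℂ H]
    [CompleteSpace H] [RKHS ℂ H X ℂ]

/-! ### Row operators and positive kernels -/

/-- The quadratic form of a Gram matrix is a squared norm. -/
theorem sum_gram {X E : Type*} [NormedAddCommGroup E] [InnerProductSpace ℂ E] (v : X → E)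
    (c : X →₀ ℂ) :
    (c.sum fun i ci => c.sum fun j cj => star ci * (inner ℂ (v i) (v j) : ℂ) * cj) =
      ((‖Finsupp.linearCombination ℂ v c‖ ^ 2 : ℝ) : ℂ) := by
  have h := inner_self_eq_norm_sq_to_K (𝕜 := ℂ) (Finsupp.linearCombination ℂ v c)
  push_cast
  refine Eq.trans ?_ h
  simp only [Finsupp.linearCombination_apply, Finsupp.sum, sum_inner, inner_sum,
    inner_smul_left, inner_smul_right, Finset.mul_sum]
  rw [Finset.sum_comm]
  refine Finset.sum_congr rfl fun i _ => Finset.sum_congr rfl fun j _ => ?_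
  simp only [RCLike.star_def]
  ring

variable (H) in
/-- The vector `(conj f₁(x) k_x, …, conj f_m(x) k_x)`, the image of the kernel function `k_x` under
the adjoint of the row operator of `f`. -/
noncomputable def conjKer {m : ℕ} (f : Fin m → X → ℂ) (x : X) : PiLp 2 (fun _ : Fin m => H) :=
  WithLp.toLp 2 fun l => conj (f l x) • RKHS.kerFun H x 1

theorem inner_ker_ker (x y : X) :
    inner ℂ (RKHS.kerFun H x 1) (RKHS.kerFun H y 1) = RKHS.kerFun H y 1 x := by
  simp only [RKHS.kerFun_inner]
  simp

theorem inner_conjKer_left {m : ℕ} (f : Fin m → X → ℂ) (x : X)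
    (g : PiLp 2 (fun _ : Fin m => H)) :
    inner ℂ (conjKer H f x) g = ∑ l, f l x * g l x := by
  simp [conjKer, PiLp.inner_apply, inner_smul_left]

theorem inner_conjKer {m : ℕ} (f : Fin m → X → ℂ) (x y : X) :
    inner ℂ (conjKer H f x) (conjKer H f y) =
      (∑ l, f l x * conj (f l y)) * RKHS.kerFun H y 1 x := by
  rw [inner_conjKer_left, Finset.sum_mul]
  simp [conjKer, mul_assoc]

theorem rowOp_apply {m : ℕ} (f : Fin m → multAlg H) (g : PiLp 2 (fun _ : Fin m => H)) (x : X) :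
    rowOp f g x = ∑ l, (f l : X → ℂ) x * g l x := by
  have h : rowOp f g x = inner ℂ (RKHS.kerFun H x (1 : ℂ)) (rowOp f g) := by simp
  rw [h, rowOp]
  simp [mulOp_apply]

theorem adjoint_rowOp_kerFun {m : ℕ} (f : Fin m → multAlg H) (x : X) :
    (rowOp f).adjoint (RKHS.kerFun H x (1 : ℂ)) = conjKer H (fun l => (f l : X → ℂ)) x := by
  refine ext_inner_right ℂ fun g => ?_
  rw [ContinuousLinearMap.adjoint_inner_left, inner_conjKer_left, RKHS.kerFun_inner, rowOp_apply]
  simp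

theorem denseRange_linearCombination_kerFun :
    DenseRange (Finsupp.linearCombination ℂ fun x : X => RKHS.kerFun H x (1 : ℂ)) := by
  have h := RKHS.kerFun_dense (𝕜 := ℂ) (X := X) (V := ℂ) H
  rw [← Submodule.dense_iff_topologicalClosure_eq_top] at h
  refine h.mono ?_
  rw [← LinearMap.coe_range, SetLike.coe_subset_coe, Submodule.span_le]
  rintro _ ⟨x, v, rfl⟩
  refine ⟨Finsupp.single x v, ?_⟩
  rw [Finsupp.linearCombination_single, ← map_smul, smul_eq_mul, mul_one]

/-- If `(1 - ∑ f_l(x) conj f_l(y)) k(x, y)` is a positive kernel, then the `f_l` are multipliers and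
their row operator is a contraction: positivity says that `k_x ↦ conjKer H f x` extends to a
contraction, and the adjoint of this extension is the row operator. -/
theorem exists_rowOp_norm_le_one {m : ℕ} (f : Fin m → X → ℂ)
    (hf : (Matrix.of fun x y : X =>
      (1 - ∑ l, f l x * conj (f l y)) * RKHS.kerFun H y (1 : ℂ) x).PosSemidef) :
    ∃ g : Fin m → multAlg H, (∀ l, (g l : X → ℂ) = f l) ∧ ‖rowOp g‖ ≤ 1 := by
  have hnorm : ∀ c : X →₀ ℂ, ‖Finsupp.linearCombination ℂ (conjKer H f) c‖ ≤
      1 * ‖Finsupp.linearCombination ℂ (fun x : X => RKHS.kerFun H x (1 : ℂ)) c‖ := by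
    intro c
    have h := hf.2 c
    simp only [Matrix.of_apply, sub_mul, one_mul, ← inner_conjKer] at h
    simp only [← inner_ker_ker, mul_sub, sub_mul, Finsupp.sum_sub] at h
    rw [sum_gram, sum_gram, sub_nonneg, Complex.real_le_real] at h
    rw [one_mul]
    exact le_of_sq_le_sq h (norm_nonneg _)
  have hd := denseRange_linearCombination_kerFun (H := H)
  set T := (Finsupp.linearCombination ℂ (conjKer H f)).extendOfNorm
    (Finsupp.linearCombination ℂ fun x : X => RKHS.kerFun H x (1 : ℂ)) with hT
  have hTx : ∀ x, T (RKHS.kerFun H x (1 : ℂ)) = conjKer H f x := by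
    intro x
    simpa using LinearMap.extendOfNorm_eq hd ⟨1, hnorm⟩ (Finsupp.single x 1)
  have hT1 : ‖T‖ ≤ 1 := LinearMap.opNorm_extendOfNorm_le hd zero_le_one hnorm
  have hA : ∀ (g : PiLp 2 (fun _ : Fin m => H)) (x : X),
      T.adjoint g x = ∑ l, f l x * g l x := by
    intro g x
    rw [← inner_conjKer_left, ← hTx, ← ContinuousLinearMap.adjoint_inner_right, RKHS.kerFun_inner]
    simp
  have hmul : ∀ l, f l ∈ multAlg H := by
    intro l h
    refine ⟨T.adjoint (WithLp.toLp 2 (Pi.single l h)), fun x => ?_⟩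
    rw [hA, Finset.sum_eq_single l] <;> simp +contextual
  refine ⟨fun l => ⟨f l, hmul l⟩, fun l => rfl, ?_⟩
  have : rowOp (fun l => (⟨f l, hmul l⟩ : multAlg H)) = T.adjoint := by
    ext g x
    rw [hA, rowOp_apply]
  rw [this, LinearIsometryEquiv.norm_map]
  exact hT1

/-- The norm of the adjoint of a row operator on a linear combination of two kernel functions. -/
theorem norm_conjKer_add_le {m : ℕ} (f : Fin m → multAlg H) (x y : X) (a b : ℂ) :
    ‖a • conjKer H (fun l => (f l : X → ℂ)) x + b • conjKer H (fun l => (f l : X → ℂ)) y‖ ≤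
      ‖rowOp f‖ * ‖a • RKHS.kerFun H x (1 : ℂ) + b • RKHS.kerFun H y (1 : ℂ)‖ := by
  have h := (rowOp f).adjoint.le_opNorm
    (a • RKHS.kerFun H x (1 : ℂ) + b • RKHS.kerFun H y (1 : ℂ))
  rwa [LinearIsometryEquiv.norm_map, map_add, map_smul, map_smul, adjoint_rowOp_kerFun,
    adjoint_rowOp_kerFun] at h

/-! ### Rows under completely bounded maps -/

theorem matOp_apply {n : ℕ} (A : Matrix (Fin n) (Fin n) (multAlg H))
    (g : PiLp 2 (fun _ : Fin n => H)) (i : Fin n) : matOp A g i = rowOp (A i) g := rfl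

theorem norm_matOp_single_row {n : ℕ} (f : Fin n → multAlg H) (i : Fin n) :
    ‖matOp (Matrix.of (Pi.single i f))‖ = ‖rowOp f‖ := by
  have key : ∀ g, ‖matOp (Matrix.of (Pi.single i f)) g‖ = ‖rowOp f g‖ := by
    intro g
    have h : matOp (Matrix.of (Pi.single i f)) g = PiLp.single 2 i (rowOp f g) := by
      ext j x
      rw [matOp_apply]
      change rowOp ((Pi.single i f : Fin n → Fin n → multAlg H) j) g x = _
      by_cases hj : j = i
      · subst hj
        simp
      · simp [hj, rowOp_apply]
    rw [h, PiLp.norm_single]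
  refine le_antisymm (ContinuousLinearMap.opNorm_le_bound _ (by positivity) fun g => ?_)
    (ContinuousLinearMap.opNorm_le_bound _ (by positivity) fun g => ?_)
  · exact (key g).trans_le ((rowOp f).le_opNorm g)
  · exact (key g).symm.trans_le (ContinuousLinearMap.le_opNorm _ g)

variable {Y : Type*} {K : Type*} [NormedAddCommGroup K] [InnerProductSpace ℂ K]
    [CompleteSpace K] [RKHS ℂ K Y ℂ]

/-- A completely bounded map acts on contractive rows with norm at most its cb norm, since a row is
the only nonzero row of a square matrix. -/
theorem norm_rowOp_map_le {m : ℕ} (φ : multAlg H →ₐ[ℂ] multAlg K) (hφ : cbNorm φ ≠ ⊤)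
    (f : Fin m → multAlg H) (hf : ‖rowOp f‖ ≤ 1) :
    ‖rowOp (fun l => φ (f l))‖ ≤ (cbNorm φ).toReal := by
  cases m with
  | zero =>
    have : rowOp (fun l : Fin 0 => φ (f l)) = 0 := by simp [rowOp]
    simp [this]
  | succ n =>
    have h1 : ‖matOp (Matrix.of (Pi.single 0 f) : Matrix (Fin (n + 1)) (Fin (n + 1)) (multAlg H))‖
        ≤ 1 := by
      rwa [norm_matOp_single_row]
    have h2 : (Matrix.of (Pi.single 0 f) : Matrix (Fin (n + 1)) (Fin (n + 1)) (multAlg H)).map φ =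
        Matrix.of (Pi.single 0 fun l => φ (f l)) := by
      ext i j
      by_cases hi : i = 0 <;> simp [hi]
    have h3 : ‖rowOp (fun l => φ (f l))‖ₑ ≤ cbNorm φ := by
      refine le_trans ?_ (le_iSup _ (n + 1))
      refine le_trans (le_of_eq ?_) (le_iSup₂ (f := fun (A : Matrix (Fin (n + 1)) (Fin (n + 1))
        (multAlg H)) (_ : ‖matOp A‖ ≤ 1) => ‖matOp (A.map φ)‖ₑ) _ h1)
      rw [h2, ← ofReal_norm, ← ofReal_norm, norm_matOp_single_row]
    have h4 := ENNReal.toReal_mono hφ h3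
    simpa using h4

theorem norm_rowOp_one [Nontrivial H] : ‖rowOp (fun _ : Fin 1 => (1 : multAlg H))‖ = 1 := by
  have h : ∀ g, ‖rowOp (fun _ : Fin 1 => (1 : multAlg H)) g‖ = ‖g‖ := by
    intro g
    have : rowOp (fun _ : Fin 1 => (1 : multAlg H)) g = g 0 := by
      ext x
      simp [rowOp_apply]
    rw [this, PiLp.norm_eq_of_L2]
    simp
  obtain ⟨v, hv⟩ := exists_ne (0 : H)
  refine ContinuousLinearMap.opNorm_eq_of_bounds zero_le_one (fun g => by rw [h, one_mul]) ?_
  intro N _ hN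
  have := hN (WithLp.toLp 2 fun _ => v)
  rw [h] at this
  refine one_le_of_le_mul_right₀ ?_ this
  rw [norm_pos_iff]
  intro h0
  exact hv (congrArg (fun g : PiLp 2 (fun _ : Fin 1 => H) => g 0) h0)

theorem one_le_toReal_cbNorm (φ : multAlg H →ₐ[ℂ] multAlg K) (hφ : cbNorm φ ≠ ⊤) [Nontrivial H]
    [Nontrivial K] : 1 ≤ (cbNorm φ).toReal := by
  simpa [norm_rowOp_one] using norm_rowOp_map_le φ hφ (fun _ : Fin 1 => 1) norm_rowOp_one.le

end RKHSMult

namespace RKHSMult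

/-! ### Two-point estimates -/

open scoped ComplexConjugate

variable {X : Type*} (H : Type*) [NormedAddCommGroup H] [InnerProductSpace ℂ H]
    [CompleteSpace H] [RKHS ℂ H X ℂ]

/-- The absolute value of the cosine of the angle between the kernel functions at `x` and `y`. It is
`0` if one of them vanishes, by the convention for division by zero. -/
noncomputable def kerCos (x y : X) : ℝ :=
  ‖(inner ℂ (RKHS.kerFun H x (1 : ℂ)) (RKHS.kerFun H y (1 : ℂ)) : ℂ)‖ /
    (‖RKHS.kerFun H x (1 : ℂ)‖ * ‖RKHS.kerFun H y (1 : ℂ)‖)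

theorem kerCos_le_one (x y : X) : kerCos H x y ≤ 1 :=
  div_le_one_of_le₀ (norm_inner_le_norm _ _) (by positivity)

variable {H}

theorem norm_conjKer_sq {m : ℕ} (f : Fin m → X → ℂ) (x : X) :
    ‖conjKer H f x‖ ^ 2 = (∑ l, ‖f l x‖ ^ 2) * ‖RKHS.kerFun H x (1 : ℂ)‖ ^ 2 := by
  rw [PiLp.norm_sq_eq_of_L2, Finset.sum_mul]
  simp [conjKer, norm_smul, mul_pow]

/-- Schwarz lemma: the value at `x` of a row of multipliers vanishing at `y` is bounded by the norm of
the row times the pseudohyperbolic distance of `x` and `y`. -/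
theorem sum_norm_sq_le_of_eq_zero {m : ℕ} (f : Fin m → multAlg H) {x y : X}
    (hx : RKHS.kerFun H x (1 : ℂ) ≠ 0) (hy : RKHS.kerFun H y (1 : ℂ) ≠ 0)
    (hf : ∀ l, (f l : X → ℂ) y = 0) :
    ∑ l, ‖(f l : X → ℂ) x‖ ^ 2 ≤ ‖rowOp f‖ ^ 2 * (1 - kerCos H x y ^ 2) := by
  set u := RKHS.kerFun H x (1 : ℂ) with hu
  set v := RKHS.kerFun H y (1 : ℂ) with hv
  have hu0 : 0 < ‖u‖ := norm_pos_iff.mpr hx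
  have hv0 : 0 < ‖v‖ := norm_pos_iff.mpr hy
  -- the combination is the component of `u` orthogonal to `v`
  have h := norm_conjKer_add_le f x y 1 (-(inner ℂ v u / (‖v‖ ^ 2 : ℝ)))
  have h0 : conjKer H (fun l => (f l : X → ℂ)) y = 0 := by
    ext l z
    simp [conjKer, hf]
  rw [h0, smul_zero, add_zero, one_smul, one_smul, ← hu, ← hv] at h
  have h2 := pow_le_pow_left₀ (norm_nonneg _) h 2
  rw [norm_conjKer_sq, mul_pow, ← hu] at h2
  have h3 : ‖u + -(inner ℂ v u / (‖v‖ ^ 2 : ℝ)) • v‖ ^ 2 = ‖u‖ ^ 2 * (1 - kerCos H x y ^ 2) := by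
    have e : ‖u + -(inner ℂ v u / (‖v‖ ^ 2 : ℝ)) • v‖ ^ 2 =
        ‖u‖ ^ 2 - ‖(inner ℂ u v : ℂ)‖ ^ 2 / ‖v‖ ^ 2 := by
      rw [norm_add_sq (𝕜 := ℂ), inner_smul_right, norm_smul, norm_neg, norm_div, Complex.norm_real,
        norm_pow, norm_norm, norm_inner_symm v u]
      have : (-(inner ℂ v u / ((‖v‖ ^ 2 : ℝ) : ℂ)) * inner ℂ u v : ℂ) =
          ((-(‖(inner ℂ u v : ℂ)‖ ^ 2 / ‖v‖ ^ 2) : ℝ) : ℂ) := by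
        have := Complex.conj_mul' (inner ℂ u v)
        rw [inner_conj_symm] at this
        push_cast
        rw [← this]
        ring
      rw [this]
      simp only [RCLike.re_to_complex, Complex.ofReal_re]
      field_simp
      ring
    rw [e, kerCos, ← hu, ← hv]
    field_simp
  rw [h3] at h2
  have h4 : ‖u‖ ^ 2 * ∑ l, ‖(f l : X → ℂ) x‖ ^ 2 ≤
      ‖u‖ ^ 2 * (‖rowOp f‖ ^ 2 * (1 - kerCos H x y ^ 2)) := by linarith
  exact le_of_mul_le_mul_left h4 (by positivity)

/-- A positive semidefinite Hermitian form in two variables has nonnegative determinant. -/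
theorem norm_sq_le_mul_of_form_nonneg {A B : ℝ} {C : ℂ}
    (h : ∀ a b : ℂ, 0 ≤ A * ‖a‖ ^ 2 + B * ‖b‖ ^ 2 + 2 * (conj a * b * C).re) :
    0 ≤ A ∧ 0 ≤ B ∧ ‖C‖ ^ 2 ≤ A * B := by
  have hA : 0 ≤ A := by simpa using h 1 0
  have hB : 0 ≤ B := by simpa using h 0 1
  refine ⟨hA, hB, ?_⟩
  by_cases hC : C = 0
  · simp [hC, mul_nonneg hA hB]
  have hC0 : (‖C‖ : ℂ) ≠ 0 := by simpa using hC
  have key : ∀ t : ℝ, 0 ≤ A * (t * t) + (-(2 * ‖C‖)) * t + B := by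
    intro t
    -- this phase makes the mixed term equal to `-t * ‖C‖`
    have h1 := h (t * (-C / ‖C‖)) 1
    have e : conj ((t : ℂ) * (-C / ‖C‖)) * 1 * C = ((-(t * ‖C‖) : ℝ) : ℂ) := by
      have := Complex.conj_mul' C
      simp only [map_mul, map_div₀, map_neg, Complex.conj_ofReal, mul_one]
      push_cast
      field_simp
      linear_combination (-(t : ℂ)) * this
    rw [e, Complex.ofReal_re] at h1
    have hn : ‖(t : ℂ) * (-C / ‖C‖)‖ ^ 2 = t * t := by
      rw [norm_mul, norm_div, norm_neg, Complex.norm_real, Complex.norm_real, norm_norm,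
        div_self (by simpa using hC), mul_one, Real.norm_eq_abs, sq_abs, sq]
    rw [hn, norm_one] at h1
    linarith
  have := discrim_le_zero key
  rw [discrim] at this
  linarith

end RKHSMult

namespace DruryArveson

open scoped ComplexConjugate
open RKHSMult

variable {d : ℕ}

/-! ### The Möbius row on the ball -/

/-- The value `|k(x, y)| / (k(x, x) k(y, y))^(1/2)` for the Drury-Arveson kernel `k`, in closed
form. -/
noncomputable def ballCos (x y : UBall d) : ℝ :=
  √(1 - ‖(x : EuclideanSpace ℂ (Fin d))‖ ^ 2) * √(1 - ‖(y : EuclideanSpace ℂ (Fin d))‖ ^ 2) /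
    ‖1 - (inner ℂ (y : EuclideanSpace ℂ (Fin d)) (x : EuclideanSpace ℂ (Fin d)) : ℂ)‖

theorem one_sub_norm_sq_pos (x : UBall d) : 0 < 1 - ‖(x : EuclideanSpace ℂ (Fin d))‖ ^ 2 := by
  have hx : ‖(x : EuclideanSpace ℂ (Fin d))‖ < 1 := mem_ball_zero_iff.mp x.2
  have := norm_nonneg (x : EuclideanSpace ℂ (Fin d))
  nlinarith

theorem one_sub_inner_ne_zero (x y : UBall d) :
    1 - (inner ℂ (y : EuclideanSpace ℂ (Fin d)) (x : EuclideanSpace ℂ (Fin d)) : ℂ) ≠ 0 := by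
  intro h
  have := norm_inner_lt_one x y
  rw [← sub_eq_zero.mp h, norm_one] at this
  exact lt_irrefl _ this

theorem ballCos_nonneg (x y : UBall d) : 0 ≤ ballCos x y := by
  unfold ballCos
  positivity

/-- The functions `z ↦ ⟨z - y, y⟩ / (1 - ⟨z, y⟩)` and
`z ↦ (1 - ‖y‖²)^(1/2) (z_i - y_i) / (1 - ⟨z, y⟩)`. They give a map of the ball `B_d` into `B_{d+1}`
that sends `y` to `0` and preserves pseudohyperbolic distances to `y`, like a
ball automorphism. -/
noncomputable def mobiusRow (y : UBall d) : Fin (d + 1) → UBall d → ℂ :=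
  Fin.cons
    (fun z => inner ℂ (y : EuclideanSpace ℂ (Fin d)) ((z : EuclideanSpace ℂ (Fin d)) - y) /
      (1 - inner ℂ (y : EuclideanSpace ℂ (Fin d)) (z : EuclideanSpace ℂ (Fin d))))
    (fun i z => (√(1 - ‖(y : EuclideanSpace ℂ (Fin d))‖ ^ 2) : ℝ) *
      ((z : EuclideanSpace ℂ (Fin d)) i - (y : EuclideanSpace ℂ (Fin d)) i) /
      (1 - inner ℂ (y : EuclideanSpace ℂ (Fin d)) (z : EuclideanSpace ℂ (Fin d))))

theorem mobiusRow_self (y : UBall d) (l : Fin (d + 1)) : mobiusRow y l y = 0 := by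
  refine Fin.cases ?_ (fun i => ?_) l <;> simp [mobiusRow]

/-- The kernel `1 - ∑ l, f_l(z) conj f_l(w)` of the Möbius row is `1 / k(z, w)` up to a factor of rank
one. -/
theorem one_sub_sum_mobiusRow (y z w : UBall d) :
    1 - ∑ l, mobiusRow y l z * conj (mobiusRow y l w) =
      ((1 - ‖(y : EuclideanSpace ℂ (Fin d))‖ ^ 2 : ℝ) : ℂ) *
        (1 - inner ℂ (w : EuclideanSpace ℂ (Fin d)) (z : EuclideanSpace ℂ (Fin d))) /
        ((1 - inner ℂ (y : EuclideanSpace ℂ (Fin d)) (z : EuclideanSpace ℂ (Fin d))) *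
          (1 - inner ℂ (w : EuclideanSpace ℂ (Fin d)) (y : EuclideanSpace ℂ (Fin d)))) := by
  have hz := one_sub_inner_ne_zero z y
  have hw := one_sub_inner_ne_zero y w
  have hr : ((√(1 - ‖(y : EuclideanSpace ℂ (Fin d))‖ ^ 2) : ℝ) : ℂ) ^ 2 =
      1 - (‖(y : EuclideanSpace ℂ (Fin d))‖ : ℂ) ^ 2 := by
    rw [← Complex.ofReal_pow, Real.sq_sqrt (one_sub_norm_sq_pos y).le]
    push_cast
    rfl
  have hsum : ∑ i, ((z : EuclideanSpace ℂ (Fin d)) i - (y : EuclideanSpace ℂ (Fin d)) i) *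
      conj ((w : EuclideanSpace ℂ (Fin d)) i - (y : EuclideanSpace ℂ (Fin d)) i) =
      inner ℂ ((w : EuclideanSpace ℂ (Fin d)) - y) ((z : EuclideanSpace ℂ (Fin d)) - y) := by
    rw [PiLp.inner_apply]
    simp [RCLike.inner_apply]
  have hyy := inner_self_eq_norm_sq_to_K (𝕜 := ℂ) (y : EuclideanSpace ℂ (Fin d))
  simp only [inner_sub_left, inner_sub_right, hyy] at hsum
  have htail : ∀ i : Fin d, mobiusRow y i.succ z * conj (mobiusRow y i.succ w) =
      (1 - (‖(y : EuclideanSpace ℂ (Fin d))‖ : ℂ) ^ 2) /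
        ((1 - inner ℂ (y : EuclideanSpace ℂ (Fin d)) (z : EuclideanSpace ℂ (Fin d))) *
          (1 - inner ℂ (w : EuclideanSpace ℂ (Fin d)) (y : EuclideanSpace ℂ (Fin d)))) *
      (((z : EuclideanSpace ℂ (Fin d)) i - (y : EuclideanSpace ℂ (Fin d)) i) *
      conj ((w : EuclideanSpace ℂ (Fin d)) i - (y : EuclideanSpace ℂ (Fin d)) i)) := by
    intro i
    simp only [mobiusRow, Fin.cons_succ, map_div₀, map_mul, map_sub, map_one, Complex.conj_ofReal,
      inner_conj_symm]
    rw [← hr]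
    field_simp
  rw [Fin.sum_univ_succ, Finset.sum_congr rfl fun i _ => htail i, ← Finset.mul_sum, hsum]
  simp only [mobiusRow, Fin.cons_zero, map_div₀, map_sub, map_one, inner_conj_symm,
    inner_sub_right, hyy]
  push_cast
  simp only [map_pow, Complex.conj_ofReal, Complex.coe_algebraMap]
  field_simp
  ring

theorem one_sub_ballCos_sq (x y : UBall d) :
    1 - ballCos x y ^ 2 = ∑ l, ‖mobiusRow y l x‖ ^ 2 := by
  have h := one_sub_sum_mobiusRow y x x
  have h1 : ∀ l, mobiusRow y l x * conj (mobiusRow y l x) =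
      ((‖mobiusRow y l x‖ ^ 2 : ℝ) : ℂ) := fun l => by
    rw [Complex.mul_conj']
    push_cast
    rfl
  have h2 : ((ballCos x y ^ 2 : ℝ) : ℂ) = ((1 - ‖(y : EuclideanSpace ℂ (Fin d))‖ ^ 2 : ℝ) : ℂ) *
        (1 - inner ℂ (x : EuclideanSpace ℂ (Fin d)) (x : EuclideanSpace ℂ (Fin d))) /
        ((1 - inner ℂ (y : EuclideanSpace ℂ (Fin d)) (x : EuclideanSpace ℂ (Fin d))) *
          (1 - inner ℂ (x : EuclideanSpace ℂ (Fin d)) (y : EuclideanSpace ℂ (Fin d)))) := by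
    have e : (1 - inner ℂ (x : EuclideanSpace ℂ (Fin d)) (y : EuclideanSpace ℂ (Fin d)) : ℂ) =
        conj (1 - inner ℂ (y : EuclideanSpace ℂ (Fin d)) (x : EuclideanSpace ℂ (Fin d))) := by
      simp
    rw [e, Complex.mul_conj', inner_self_eq_norm_sq_to_K (𝕜 := ℂ), ballCos, div_pow, mul_pow,
      Real.sq_sqrt (one_sub_norm_sq_pos x).le, Real.sq_sqrt (one_sub_norm_sq_pos y).le]
    push_cast
    simp only [Complex.coe_algebraMap]
    ring
  rw [← h2, Finset.sum_congr rfl fun l _ => h1 l, ← Complex.ofReal_sum] at h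
  have h' : 1 - ∑ l, ‖mobiusRow y l x‖ ^ 2 = ballCos x y ^ 2 := by exact_mod_cast h
  linarith

theorem ballCos_le_one (x y : UBall d) : ballCos x y ≤ 1 := by
  have h := one_sub_ballCos_sq x y
  have h' : 0 ≤ ∑ l, ‖mobiusRow y l x‖ ^ 2 := by positivity
  have := ballCos_nonneg x y
  nlinarith

theorem ballCos_lt_one {x y : UBall d} (hxy : x ≠ y) : ballCos x y < 1 := by
  have h : 0 < 1 - ballCos x y ^ 2 := by
    rw [one_sub_ballCos_sq]
    refine lt_of_le_of_ne (Finset.sum_nonneg fun l _ => by positivity) fun h0 => hxy ?_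
    have h1 := (Finset.sum_eq_zero_iff_of_nonneg fun l _ => by positivity).mp h0.symm
    refine Subtype.ext (PiLp.ext fun i => ?_)
    have h2 := h1 i.succ (Finset.mem_univ _)
    have hr := (Real.sqrt_pos.mpr (one_sub_norm_sq_pos y)).ne'
    simpa [mobiusRow, one_sub_inner_ne_zero x y, hr, sub_eq_zero] using h2
  have := ballCos_nonneg x y
  nlinarith

end DruryArveson

namespace DruryArveson

open scoped ComplexConjugate
open RKHSMult

variable {d : ℕ}

/-! ### Contractive rows on subsets of the ball -/

theorem coe_kerFun_HV (V : Set (UBall d)) (x : V) :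
    (RKHS.kerFun (HV V) x (1 : ℂ) : H2 d) = kerFun (x : UBall d) := by
  have hmem : kerFun (x : UBall d) ∈ HV V :=
    Submodule.le_topologicalClosure _ (Submodule.subset_span ⟨x, x.2, rfl⟩)
  have : RKHS.kerFun (HV V) x (1 : ℂ) = ⟨kerFun (x : UBall d), hmem⟩ := by
    refine ext_inner_right ℂ fun h => ?_
    rw [RKHS.kerFun_inner, Submodule.coe_inner, inner_kerFun, HV_apply]
    simp
  rw [this]

theorem kerFun_HV_apply (V : Set (UBall d)) (x y : V) :
    RKHS.kerFun (HV V) y (1 : ℂ) x = ker (x : UBall d) y := by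
  rw [HV_apply, coe_kerFun_HV, kerFun_apply]

theorem norm_kerFun_HV_sq (V : Set (UBall d)) (x : V) :
    ‖RKHS.kerFun (HV V) x (1 : ℂ)‖ ^ 2 =
      (1 - ‖((x : UBall d) : EuclideanSpace ℂ (Fin d))‖ ^ 2)⁻¹ := by
  have h := inner_self_eq_norm_sq_to_K (𝕜 := ℂ) (RKHS.kerFun (HV V) x (1 : ℂ))
  rw [inner_ker_ker, kerFun_HV_apply, ker, inner_self_eq_norm_sq_to_K (𝕜 := ℂ)] at h
  simp only [Complex.coe_algebraMap] at h
  have h' : ((1 / (1 - ‖((x : UBall d) : EuclideanSpace ℂ (Fin d))‖ ^ 2) : ℝ) : ℂ) =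
      ((‖RKHS.kerFun (HV V) x (1 : ℂ)‖ ^ 2 : ℝ) : ℂ) := by
    push_cast
    exact h
  rw [← Complex.ofReal_inj.mp h', one_div]

theorem kerFun_HV_ne_zero (V : Set (UBall d)) (x : V) : RKHS.kerFun (HV V) x (1 : ℂ) ≠ 0 := by
  rw [← norm_pos_iff]
  refine lt_of_le_of_ne (norm_nonneg _) fun h => ?_
  have h1 := norm_kerFun_HV_sq V x
  have h2 := inv_pos.mpr (one_sub_norm_sq_pos (x : UBall d))
  rw [← h1, ← h] at h2
  simp at h2

theorem kerCos_HV (V : Set (UBall d)) (x y : V) :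
    kerCos (HV V) x y = ballCos (x : UBall d) y := by
  have h : ∀ z : V, ‖RKHS.kerFun (HV V) z (1 : ℂ)‖ =
      (√(1 - ‖((z : UBall d) : EuclideanSpace ℂ (Fin d))‖ ^ 2))⁻¹ := fun z => by
    rw [← Real.sqrt_inv, ← norm_kerFun_HV_sq, Real.sqrt_sq (norm_nonneg _)]
  rw [kerCos, inner_ker_ker, kerFun_HV_apply, h, h, ker, ballCos, norm_div, norm_one]
  have hx := (Real.sqrt_pos.mpr (one_sub_norm_sq_pos (x : UBall d))).ne'
  have hy := (Real.sqrt_pos.mpr (one_sub_norm_sq_pos (y : UBall d))).ne'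
  have hi := norm_ne_zero_iff.mpr (one_sub_inner_ne_zero (x : UBall d) y)
  field_simp

theorem exists_mobiusRow_multiplier (V : Set (UBall d)) (y : UBall d) :
    ∃ g : Fin (d + 1) → MV V, (∀ l, (g l : V → ℂ) = fun z : V => mobiusRow y l z) ∧
      ‖rowOp g‖ ≤ 1 := by
  refine exists_rowOp_norm_le_one (H := HV V) (fun l (z : V) => mobiusRow y l z) ?_
  have h := posSemidef_gram fun z : V => (√(1 - ‖(y : EuclideanSpace ℂ (Fin d))‖ ^ 2) : ℂ) /
    (1 - inner ℂ ((z : UBall d) : EuclideanSpace ℂ (Fin d)) (y : EuclideanSpace ℂ (Fin d)))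
  convert h using 1
  ext z w
  have hr : ((√(1 - ‖(y : EuclideanSpace ℂ (Fin d))‖ ^ 2) : ℝ) : ℂ) ^ 2 =
      1 - (‖(y : EuclideanSpace ℂ (Fin d))‖ : ℂ) ^ 2 := by
    rw [← Complex.ofReal_pow, Real.sq_sqrt (one_sub_norm_sq_pos y).le]
    push_cast
    rfl
  have hz := one_sub_inner_ne_zero (z : UBall d) y
  have hw := one_sub_inner_ne_zero y (w : UBall d)
  have hzw := one_sub_inner_ne_zero (z : UBall d) w
  rw [Matrix.of_apply, Matrix.of_apply, kerFun_HV_apply, one_sub_sum_mobiusRow, ker,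
    RCLike.inner_apply, map_div₀, map_sub, map_one, inner_conj_symm, Complex.conj_ofReal]
  push_cast
  rw [← hr]
  field_simp

theorem exists_coord_multiplier (V : Set (UBall d)) :
    ∃ g : Fin d → MV V,
      (∀ l, (g l : V → ℂ) = fun z : V => ((z : UBall d) : EuclideanSpace ℂ (Fin d)) l) ∧
      ‖rowOp g‖ ≤ 1 := by
  refine exists_rowOp_norm_le_one (H := HV V)
    (fun l (z : V) => ((z : UBall d) : EuclideanSpace ℂ (Fin d)) l) ?_
  have h := posSemidef_gram fun _ : V => (1 : ℂ)
  convert h using 1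
  ext z w
  have hzw := one_sub_inner_ne_zero (z : UBall d) w
  have hs : ∑ l, ((z : UBall d) : EuclideanSpace ℂ (Fin d)) l *
      conj (((w : UBall d) : EuclideanSpace ℂ (Fin d)) l) =
      inner ℂ ((w : UBall d) : EuclideanSpace ℂ (Fin d)) (z : UBall d) := by
    rw [PiLp.inner_apply]
    simp [RCLike.inner_apply]
  rw [Matrix.of_apply, Matrix.of_apply, kerFun_HV_apply, hs, ker, mul_one_div, div_self hzw]
  simp

/-! ### Transport along a completely bounded composition map -/

theorem isVecMultiplier_comp {V W : Set (UBall d)} (φ : MV V →ₐ[ℂ] MV W) (E : W → V)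
    (hE : ∀ (f : MV V) (y : W), (φ f : W → ℂ) y = (f : V → ℂ) (E y)) : IsVecMultiplier (HV W)
    (fun y : W => ((E y : UBall d) : EuclideanSpace ℂ (Fin d))) := by
  obtain ⟨g, hg, -⟩ := exists_coord_multiplier V
  intro i
  have : (fun y : W => ((E y : UBall d) : EuclideanSpace ℂ (Fin d)) i) = φ (g i) := by
    ext y
    rw [hE, hg]
  rw [this]
  exact (φ (g i)).2

theorem vecMultNorm_comp_le {V W : Set (UBall d)} (φ : MV V →ₐ[ℂ] MV W)
    (hφ : cbNorm φ ≠ ⊤) (E : W → V)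
    (hE : ∀ (f : MV V) (y : W), (φ f : W → ℂ) y = (f : V → ℂ) (E y))
    (h : IsVecMultiplier (HV W)
    (fun y : W => ((E y : UBall d) : EuclideanSpace ℂ (Fin d)))) :
    vecMultNorm (HV W) _ h ≤ (cbNorm φ).toReal := by
  obtain ⟨g, hg, hg1⟩ := exists_coord_multiplier V
  refine le_of_eq_of_le ?_ (norm_rowOp_map_le φ hφ g hg1)
  rw [vecMultNorm]
  congr 2
  funext i
  refine Subtype.ext (funext fun y => ?_)
  rw [hE, hg]

/-- A composition homomorphism `f ↦ f ∘ E` bounds the pseudohyperbolic distance of `E x` and `E y` by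
its cb norm times that of `x` and `y`. -/
theorem one_sub_ballCos_sq_comp_le {V W : Set (UBall d)} (φ : MV V →ₐ[ℂ] MV W)
    (hφ : cbNorm φ ≠ ⊤) (E : W → V)
    (hE : ∀ (f : MV V) (y : W), (φ f : W → ℂ) y = (f : V → ℂ) (E y))
    (x y : W) :
    1 - ballCos (E x : UBall d) (E y) ^ 2 ≤
      (cbNorm φ).toReal ^ 2 * (1 - ballCos (x : UBall d) y ^ 2) := by
  obtain ⟨g, hg, hg1⟩ := exists_mobiusRow_multiplier V (E y)
  have h := sum_norm_sq_le_of_eq_zero (fun l => φ (g l)) (kerFun_HV_ne_zero W x)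
    (kerFun_HV_ne_zero W y) fun l => by
      rw [hE, hg]
      exact mobiusRow_self _ l
  have h1 := norm_rowOp_map_le φ hφ g hg1
  have h2 : 0 ≤ 1 - ballCos (x : UBall d) y ^ 2 := by
    rw [one_sub_ballCos_sq]
    positivity
  rw [one_sub_ballCos_sq]
  simp only [hE, hg, kerCos_HV] at h
  exact h.trans (by gcongr)

/-! ### Strict contractions separate kernel functions less -/

section

variable {X : Type*} {H : Type*} [NormedAddCommGroup H] [InnerProductSpace ℂ H]
  [CompleteSpace H] [RKHS ℂ H X ℂ]

/-- With `R` the multiplier norm of `E`, the `2 × 2` matrix of the entries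
`(R² - ⟨E x_i, E x_j⟩) k(x_i, x_j)` has nonnegative diagonal and determinant. -/
theorem norm_sub_inner_mul_kerCos_le (E : X → UBall d)
    (h : IsVecMultiplier H fun x => (E x : EuclideanSpace ℂ (Fin d))) {x y : X}
    (hx : RKHS.kerFun H x (1 : ℂ) ≠ 0) (hy : RKHS.kerFun H y (1 : ℂ) ≠ 0) :
    ‖(E x : EuclideanSpace ℂ (Fin d))‖ ^ 2 ≤ vecMultNorm H _ h ^ 2 ∧
    ‖(E y : EuclideanSpace ℂ (Fin d))‖ ^ 2 ≤ vecMultNorm H _ h ^ 2 ∧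
    (kerCos H x y * ‖(vecMultNorm H _ h ^ 2 : ℂ) -
      inner ℂ (E y : EuclideanSpace ℂ (Fin d)) (E x : EuclideanSpace ℂ (Fin d))‖) ^ 2 ≤
    (vecMultNorm H _ h ^ 2 - ‖(E x : EuclideanSpace ℂ (Fin d))‖ ^ 2) *
      (vecMultNorm H _ h ^ 2 - ‖(E y : EuclideanSpace ℂ (Fin d))‖ ^ 2) := by
  set R := vecMultNorm H _ h
  set u := RKHS.kerFun H x (1 : ℂ) with hu
  set v := RKHS.kerFun H y (1 : ℂ) with hv
  have hu0 : 0 < ‖u‖ := norm_pos_iff.mpr hx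
  have hv0 : 0 < ‖v‖ := norm_pos_iff.mpr hy
  have hG : ∑ l, (E x : EuclideanSpace ℂ (Fin d)) l * conj ((E y : EuclideanSpace ℂ (Fin d)) l) =
      inner ℂ (E y : EuclideanSpace ℂ (Fin d)) (E x : EuclideanSpace ℂ (Fin d)) := by
    rw [PiLp.inner_apply]
    simp [RCLike.inner_apply]
  set f : Fin d → X → ℂ := fun i z => (E z : EuclideanSpace ℂ (Fin d)) i with hf
  set G : ℂ := inner ℂ (E y : EuclideanSpace ℂ (Fin d)) (E x : EuclideanSpace ℂ (Fin d))
  have hn : ∀ z, ‖conjKer H f z‖ ^ 2 =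
      ‖(E z : EuclideanSpace ℂ (Fin d))‖ ^ 2 * ‖RKHS.kerFun H z (1 : ℂ)‖ ^ 2 := fun z => by
    rw [norm_conjKer_sq, EuclideanSpace.norm_sq_eq]
  have hinner : inner ℂ (conjKer H f x) (conjKer H f y) = G * inner ℂ u v := by
    rw [inner_conjKer, hu, hv, inner_ker_ker, ← hG]
  have hform : ∀ a b : ℂ, 0 ≤ ((R ^ 2 - ‖(E x : EuclideanSpace ℂ (Fin d))‖ ^ 2) * ‖u‖ ^ 2) *
      ‖a‖ ^ 2 + ((R ^ 2 - ‖(E y : EuclideanSpace ℂ (Fin d))‖ ^ 2) * ‖v‖ ^ 2) * ‖b‖ ^ 2 +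
      2 * (conj a * b * (((R : ℂ) ^ 2 - G) * inner ℂ u v)).re := by
    intro a b
    have h1 : ‖a • conjKer H f x + b • conjKer H f y‖ ≤ R * ‖a • u + b • v‖ :=
      norm_conjKer_add_le (fun i => ⟨f i, h i⟩) x y a b
    have h2 := pow_le_pow_left₀ (norm_nonneg _) h1 2
    rw [mul_pow, norm_add_sq (𝕜 := ℂ), norm_add_sq (𝕜 := ℂ)] at h2
    simp only [norm_smul, mul_pow, inner_smul_left, inner_smul_right, hn, hinner, ← hu, ← hv,
      RCLike.re_to_complex] at h2
    have h3 : (conj a * b * (((R : ℂ) ^ 2 - G) * inner ℂ u v)).re =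
        R ^ 2 * (b * (conj a * inner ℂ u v)).re - (b * (conj a * (G * inner ℂ u v))).re := by
      rw [← Complex.re_ofReal_mul, ← Complex.sub_re]
      congr 1
      push_cast
      ring
    rw [h3]
    linarith
  obtain ⟨hA, hB, hC⟩ := norm_sq_le_mul_of_form_nonneg hform
  refine ⟨?_, ?_, ?_⟩
  · exact sub_nonneg.mp (nonneg_of_mul_nonneg_left hA (by positivity))
  · exact sub_nonneg.mp (nonneg_of_mul_nonneg_left hB (by positivity))
  · rw [kerCos, ← hu, ← hv, div_mul_eq_mul_div, div_pow, div_le_iff₀ (by positivity)]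
    rw [norm_mul] at hC
    linarith

/-- With `p = σ * q`, the hypotheses give `τ ≤ (p - s) / (q - s)`, which is smaller than `p / q` by
at least `s / 2 * (1 - σ)` since `q ≤ 2`. -/
theorem one_add_mul_one_sub_le {s q τ σ D : ℝ} (hs : 0 ≤ s) (hq : 0 < q) (hq2 : q ≤ 2)
    (hτ0 : 0 ≤ τ) (hτ : τ ≤ 1) (hσ : σ ≤ 1) (hsq : s ≤ σ * q) (hD : q - s ≤ D)
    (h : τ * D ≤ σ * q - s) : (1 + s / 2) * (1 - σ) ≤ 1 - τ := by
  have h5 : q * (1 - σ) ≤ (1 - τ) * (q - s) := by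
    linarith [mul_le_mul_of_nonneg_left hD hτ0]
  have h6 : σ * q ≤ q := mul_le_of_le_one_left hq.le hσ
  rcases (sub_nonneg.mpr (hsq.trans h6)).eq_or_lt with h0 | h0
  · rw [← h0, mul_zero] at h5
    have h7 : 1 - σ = 0 := le_antisymm (nonpos_of_mul_nonpos_right h5 hq) (sub_nonneg.mpr hσ)
    rw [h7, mul_zero]
    exact sub_nonneg.mpr hτ
  · refine le_of_mul_le_mul_right (le_trans ?_ h5) h0
    have h7 : (1 + s / 2) * (q - s) ≤ q := by
      linarith [mul_le_mul_of_nonneg_left hq2 hs, mul_nonneg hs hs]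
    linarith [mul_le_mul_of_nonneg_right h7 (sub_nonneg.mpr hσ)]

/-- A map into the ball of multiplier norm `R ≤ 1` brings two points closer by a factor depending
only on `R`, which is strict if `R < 1`. -/
theorem one_sub_ballCos_le (E : X → UBall d)
    (h : IsVecMultiplier H fun x => (E x : EuclideanSpace ℂ (Fin d))) {x y : X}
    (hx : RKHS.kerFun H x (1 : ℂ) ≠ 0) (hy : RKHS.kerFun H y (1 : ℂ) ≠ 0)
    (hR : vecMultNorm H _ h ≤ 1) :
    (1 + (1 - vecMultNorm H _ h ^ 2) / 2) * (1 - ballCos (E x) (E y)) ≤ 1 - kerCos H x y := by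
  obtain ⟨h1, h2, h3⟩ := norm_sub_inner_mul_kerCos_le E h hx hy
  have hR0 : 0 ≤ vecMultNorm H _ h := by unfold vecMultNorm; positivity
  have hpx := one_sub_norm_sq_pos (E x)
  have hpy := one_sub_norm_sq_pos (E y)
  have hq0 := norm_pos_iff.mpr (one_sub_inner_ne_zero (E x) (E y))
  have hq2 : ‖1 - (inner ℂ (E y : EuclideanSpace ℂ (Fin d))
      (E x : EuclideanSpace ℂ (Fin d)) : ℂ)‖ ≤ 2 := by
    refine (norm_sub_le _ _).trans ?_
    rw [norm_one]
    linarith [norm_inner_lt_one (E x) (E y)]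
  have hτE := ballCos_le_one (E x) (E y)
  have hτ := kerCos_le_one H x y
  have hτ0 : 0 ≤ kerCos H x y := by unfold kerCos; positivity
  have hp : √(1 - ‖(E x : EuclideanSpace ℂ (Fin d))‖ ^ 2) *
      √(1 - ‖(E y : EuclideanSpace ℂ (Fin d))‖ ^ 2) = ballCos (E x) (E y) *
      ‖1 - (inner ℂ (E y : EuclideanSpace ℂ (Fin d)) (E x : EuclideanSpace ℂ (Fin d)) : ℂ)‖ := by
    rw [ballCos, div_mul_cancel₀ _ hq0.ne']
  have hqs : ‖1 - (inner ℂ (E y : EuclideanSpace ℂ (Fin d))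
      (E x : EuclideanSpace ℂ (Fin d)) : ℂ)‖ - (1 - vecMultNorm H _ h ^ 2) ≤
      ‖(vecMultNorm H _ h ^ 2 : ℂ) -
      inner ℂ (E y : EuclideanSpace ℂ (Fin d)) (E x : EuclideanSpace ℂ (Fin d))‖ := by
    have e : 1 - (inner ℂ (E y : EuclideanSpace ℂ (Fin d)) (E x : EuclideanSpace ℂ (Fin d)) : ℂ) =
        ((vecMultNorm H _ h ^ 2 : ℂ) -
          inner ℂ (E y : EuclideanSpace ℂ (Fin d)) (E x : EuclideanSpace ℂ (Fin d))) +
        ((1 - vecMultNorm H _ h ^ 2 : ℝ) : ℂ) := by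
      push_cast
      ring
    have h6 := norm_add_le ((vecMultNorm H _ h ^ 2 : ℂ) -
      inner ℂ (E y : EuclideanSpace ℂ (Fin d)) (E x : EuclideanSpace ℂ (Fin d)))
      ((1 - vecMultNorm H _ h ^ 2 : ℝ) : ℂ)
    rw [← e, Complex.norm_of_nonneg (by nlinarith)] at h6
    linarith
  have hsx := Real.sq_sqrt hpx.le
  have hsy := Real.sq_sqrt hpy.le
  have hsx0 := Real.sqrt_nonneg (1 - ‖(E x : EuclideanSpace ℂ (Fin d))‖ ^ 2)
  have hsy0 := Real.sqrt_nonneg (1 - ‖(E y : EuclideanSpace ℂ (Fin d))‖ ^ 2)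
  set q := ‖1 - (inner ℂ (E y : EuclideanSpace ℂ (Fin d))
      (E x : EuclideanSpace ℂ (Fin d)) : ℂ)‖
  set D := ‖(vecMultNorm H _ h ^ 2 : ℂ) -
      inner ℂ (E y : EuclideanSpace ℂ (Fin d)) (E x : EuclideanSpace ℂ (Fin d))‖
  set r := √(1 - ‖(E x : EuclideanSpace ℂ (Fin d))‖ ^ 2)
  set t := √(1 - ‖(E y : EuclideanSpace ℂ (Fin d))‖ ^ 2)
  set R := vecMultNorm H _ h
  set τ := kerCos H x y
  set σ := ballCos (E x) (E y)
  set s := 1 - R ^ 2 with hs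
  have hs0 : 0 ≤ s := by nlinarith
  have hrs : s ≤ r ^ 2 := by linarith
  have hts : s ≤ t ^ 2 := by linarith
  have hps : s ≤ r * t := by
    refine le_of_sq_le_sq ?_ (by positivity)
    nlinarith
  -- the mixed terms compare by the inequality `2 * r * t ≤ r ^ 2 + t ^ 2`
  have h3' : (τ * D) ^ 2 ≤ (r * t - s) ^ 2 := by
    have : R ^ 2 - ‖(E x : EuclideanSpace ℂ (Fin d))‖ ^ 2 = r ^ 2 - s := by linarith
    rw [this] at h3
    have : R ^ 2 - ‖(E y : EuclideanSpace ℂ (Fin d))‖ ^ 2 = t ^ 2 - s := by linarith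
    rw [this] at h3
    nlinarith [mul_nonneg hs0 (sq_nonneg (r - t))]
  have h4 : τ * D ≤ r * t - s := le_of_sq_le_sq h3' (by linarith)
  exact one_add_mul_one_sub_le hs0 hq0 hq2 hτ0 hτ hτE (hp ▸ hps) hqs (hp ▸ h4)

end

end DruryArveson

namespace DruryArveson

open RKHSMult Filter Topology

/-! ### Limits -/

/-- The lower bound for the multiplier norm of `E` read off from two points with distinct images. The
minimum with `1` covers maps of multiplier norm larger than `1`. -/
theorem min_le_vecMultNorm {d : ℕ} {V : Set (UBall d)} (E : V → UBall d)
    (h : IsVecMultiplier (HV V) fun x => (E x : EuclideanSpace ℂ (Fin d))) {x y : V}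
    (hE : E x ≠ E y) :
    √(min 1 (1 - 2 * ((1 - ballCos (x : UBall d) y) / (1 - ballCos (E x) (E y)) - 1))) ≤
      vecMultNorm (HV V) _ h := by
  have hR0 : 0 ≤ vecMultNorm (HV V) _ h := by unfold vecMultNorm; positivity
  rw [Real.sqrt_le_left hR0]
  rcases le_total 1 (vecMultNorm (HV V) _ h) with h1 | h1
  · exact (min_le_left _ _).trans (one_le_pow₀ h1)
  · refine (min_le_right _ _).trans ?_
    have h2 := one_sub_ballCos_le E h (kerFun_HV_ne_zero V x) (kerFun_HV_ne_zero V y) h1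
    rw [kerCos_HV, ← le_div_iff₀ (sub_pos.mpr (ballCos_lt_one hE))] at h2
    linarith

theorem tendsto_toReal_of_tendsto_mul {a b : ℕ → ENNReal} (ha1 : ∀ n, 1 ≤ (a n).toReal)
    (hb1 : ∀ n, 1 ≤ (b n).toReal)
    (h : Tendsto (fun n => a n * b n) atTop (𝓝 1)) :
    Tendsto (fun n => (a n).toReal) atTop (𝓝 1) := by
  have h1 := (ENNReal.tendsto_toReal ENNReal.one_ne_top).comp h
  refine tendsto_of_tendsto_of_tendsto_of_le_of_le tendsto_const_nhds h1 ha1 fun n => ?_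
  simp only [Function.comp, ENNReal.toReal_mul]
  exact le_mul_of_one_le_right (zero_le_one.trans (ha1 n)) (hb1 n)

theorem tendsto_of_one_sub_sq_le {a b u : ℕ → ℝ} {t : ℝ} (ha : Tendsto a atTop (𝓝 1))
    (hb : Tendsto b atTop (𝓝 1)) (ha1 : ∀ n, 1 ≤ a n) (ht : 0 ≤ t) (hu0 : ∀ n, 0 ≤ u n)
    (hub : ∀ n, 1 - u n ^ 2 ≤ b n ^ 2 * (1 - t ^ 2))
    (hua : ∀ n, 1 - t ^ 2 ≤ a n ^ 2 * (1 - u n ^ 2)) : Tendsto u atTop (𝓝 t) := by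
  have hsq : Tendsto (fun n => 1 - u n ^ 2) atTop (𝓝 (1 - t ^ 2)) := by
    refine tendsto_of_tendsto_of_tendsto_of_le_of_le (g := fun n => (1 - t ^ 2) / a n ^ 2)
      (h := fun n => b n ^ 2 * (1 - t ^ 2)) ?_ ?_ (fun n => ?_) hub
    · have h := (tendsto_const_nhds (x := 1 - t ^ 2)).div (ha.pow 2) (by norm_num)
      rwa [one_pow, div_one] at h
    · simpa using (hb.pow 2).mul_const (1 - t ^ 2)
    · have := ha1 n
      rw [div_le_iff₀ (by positivity), mul_comm]
      exact hua n
  have h := (hsq.const_sub 1).sqrt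
  simpa [Real.sqrt_sq, ht, hu0] using h

theorem tendsto_sqrt_min {v w : ℕ → ℝ} {s : ℝ} (hv : Tendsto v atTop (𝓝 s))
    (hw : Tendsto w atTop (𝓝 s)) (hs : s ≠ 0) :
    Tendsto (fun n => √(min 1 (1 - 2 * (v n / w n - 1)))) atTop (𝓝 1) := by
  have h := ((tendsto_const_nhds (x := (1 : ℝ))).min
    ((((hv.div hw hs).sub_const 1).const_mul 2).const_sub 1)).sqrt
  simpa [div_self hs] using h

end DruryArveson

open DruryArveson RKHSMult Filter Topology

theorem theorem8p0p3 {d : ℕ} (V : Set (DruryArveson.UBall d)) (hV : DruryArveson.IsVariety V)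
    (hV2 : V.Nontrivial)
    (W : ℕ → Set (DruryArveson.UBall d)) (hW : ∀ n, DruryArveson.IsVariety (W n))
    (F : ∀ n, V ≃ W n)
    (φ : ∀ n, DruryArveson.MV V ≃ₐ[ℂ] DruryArveson.MV (W n))
    (hφ : ∀ n, RKHSMult.IsMultAlgIso (φ n))
    (hφF : ∀ (n : ℕ) (f : DruryArveson.MV V) (y : W n),
      (φ n f : W n → ℂ) y = (f : V → ℂ) ((F n).symm y))
    (hcb : Filter.Tendsto
      (fun n => RKHSMult.cbNorm (φ n).toAlgHom *
        RKHSMult.cbNorm (φ n).symm.toAlgHom)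
      Filter.atTop (nhds 1)) :
    ∃ (hF : ∀ n, RKHSMult.IsVecMultiplier (DruryArveson.HV V)
          (fun x : V => ((F n x : DruryArveson.UBall d) : EuclideanSpace ℂ (Fin d))))
      (hG : ∀ n, RKHSMult.IsVecMultiplier (DruryArveson.HV (W n))
          (fun y : W n => (((F n).symm y : DruryArveson.UBall d) : EuclideanSpace ℂ (Fin d)))),
      Filter.Tendsto (fun n => RKHSMult.vecMultNorm (DruryArveson.HV V) _ (hF n))
        Filter.atTop (nhds 1) ∧
      Filter.Tendsto (fun n => RKHSMult.vecMultNorm (DruryArveson.HV (W n)) _ (hG n))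
        Filter.atTop (nhds 1) := by
  have hφF' : ∀ (n : ℕ) (f : MV (W n)) (x : V),
      ((φ n).symm.toAlgHom f : V → ℂ) x = (f : W n → ℂ) (F n x) := by
    intro n f x
    have h := hφF n ((φ n).symm f) (F n x)
    rw [AlgEquiv.apply_symm_apply, Equiv.symm_apply_apply] at h
    exact h.symm
  have hφF1 : ∀ (n : ℕ) (f : MV V) (y : W n),
      ((φ n).toAlgHom f : W n → ℂ) y = (f : V → ℂ) ((F n).symm y) := hφF
  have ha : ∀ n, cbNorm (φ n).toAlgHom ≠ ⊤ := fun n => (hφ n).cb.ne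
  have hb : ∀ n, cbNorm (φ n).symm.toAlgHom ≠ ⊤ := fun n => (hφ n).cb_symm.ne
  obtain ⟨x, hx, y, hy, hxy⟩ := hV2
  let t := ballCos x y
  let u : ℕ → ℝ := fun n => ballCos (F n ⟨x, hx⟩ : UBall d) (F n ⟨y, hy⟩)
  have hVn : Nontrivial (HV V) := ⟨_, 0, kerFun_HV_ne_zero V ⟨x, hx⟩⟩
  have hWn : ∀ n, Nontrivial (HV (W n)) := fun n => ⟨_, 0, kerFun_HV_ne_zero (W n) (F n ⟨x, hx⟩)⟩
  have ha1 : ∀ n, 1 ≤ (cbNorm (φ n).toAlgHom).toReal := fun n => one_le_toReal_cbNorm _ (ha n)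
  have hb1 : ∀ n, 1 ≤ (cbNorm (φ n).symm.toAlgHom).toReal := fun n =>
    one_le_toReal_cbNorm _ (hb n)
  have hat := tendsto_toReal_of_tendsto_mul ha1 hb1 hcb
  have hbt := tendsto_toReal_of_tendsto_mul hb1 ha1 (hcb.congr fun n => mul_comm _ _)
  have hF := fun n => isVecMultiplier_comp (φ n).symm.toAlgHom (F n) (hφF' n)
  have hG := fun n => isVecMultiplier_comp (φ n).toAlgHom (F n).symm (hφF1 n)
  have hFle := fun n => vecMultNorm_comp_le (φ n).symm.toAlgHom (hb n) (F n) (hφF' n) (hF n)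
  have hGle := fun n => vecMultNorm_comp_le (φ n).toAlgHom (ha n) (F n).symm (hφF1 n) (hG n)
  have ht1 : t < 1 := ballCos_lt_one hxy
  have hne : ∀ n, (F n ⟨x, hx⟩ : UBall d) ≠ F n ⟨y, hy⟩ := by
    intro n h
    exact hxy (congrArg Subtype.val ((F n).injective (Subtype.ext h)))
  have hle1 : ∀ n, 1 - u n ^ 2 ≤ (cbNorm (φ n).symm.toAlgHom).toReal ^ 2 * (1 - t ^ 2) :=
    fun n => one_sub_ballCos_sq_comp_le _ (hb n) _ (hφF' n) ⟨x, hx⟩ ⟨y, hy⟩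
  have hle2 : ∀ n, 1 - t ^ 2 ≤ (cbNorm (φ n).toAlgHom).toReal ^ 2 * (1 - u n ^ 2) := by
    intro n
    have h := one_sub_ballCos_sq_comp_le _ (ha n) _ (hφF1 n) (F n ⟨x, hx⟩) (F n ⟨y, hy⟩)
    rwa [Equiv.symm_apply_apply, Equiv.symm_apply_apply] at h
  have hut : Tendsto u atTop (𝓝 t) :=
    tendsto_of_one_sub_sq_le hat hbt ha1 (ballCos_nonneg _ _) (fun n => ballCos_nonneg _ _)
      hle1 hle2
  have h1t : 1 - t ≠ 0 := (sub_pos.mpr ht1).ne'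
  have hlF : ∀ n, √(min 1 (1 - 2 * ((1 - t) / (1 - u n) - 1))) ≤ vecMultNorm (HV V) _ (hF n) :=
    fun n => min_le_vecMultNorm (fun z => (F n z : UBall d)) (hF n)
      (x := ⟨x, hx⟩) (y := ⟨y, hy⟩) (hne n)
  have hlG : ∀ n, √(min 1 (1 - 2 * ((1 - u n) / (1 - t) - 1))) ≤
      vecMultNorm (HV (W n)) _ (hG n) := by
    intro n
    have h := min_le_vecMultNorm (fun z => ((F n).symm z : UBall d)) (hG n) (x := F n ⟨x, hx⟩)
      (y := F n ⟨y, hy⟩)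
    simp only [Equiv.symm_apply_apply] at h
    exact h hxy
  exact ⟨hF, hG,
    tendsto_of_tendsto_of_tendsto_of_le_of_le
      (tendsto_sqrt_min tendsto_const_nhds (hut.const_sub 1) h1t) hbt hlF hFle,
    tendsto_of_tendsto_of_tendsto_of_le_of_le
      (tendsto_sqrt_min (hut.const_sub 1) tendsto_const_nhds h1t) hat hlG hGle⟩
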